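/- **Setting.** Let $F:\mathbb R^d\times\mathbb R^s\to\mathbb R$ be locally Lipschitz, let $G:\mathbb R^d\times\mathbb R^s\to\mathbb R^p$, $H:\mathbb R^d\times\mathbb R^s\to\mathbb R^q$, $f:\mathbb R^d\times\mathbb R^s\to\mathbb R$, $g:\mathbb R^d\times\mathbb R^s\to\mathbb R^m$, $h:\mathbb R^d\times\mathbb R^s\to\mathbb R^n$ be continuously differentiable, and let the partial gradients $\nabla_y f,\nabla_y g_i,\nabla_y h_j$ be continuously differentiable functions of $(x,y)$. Put $Y(x)=\{y: g(x,y)\le 0,\ h(x,y)=0\}$, $V(x)=\inf_{y\in Y(x)} f(x,y)\in[-\infty,\infty]$, $\nabla_yL(x,y,u,v)=\nabla_yf(x,y)+\nabla_yg(x,y)^Tu+\nabla_yh(x,y)^Tv$, $\Omega=\{(a,b)\in\mathbb R^2: 0\le a\perp b\ge 0\}$, and consider the combined program $$\text{(CP)}\quad \min_{x,y,u,v} F(x,y)\ \text{ s.t. } f(x,y)-V(x)\le 0,\ G(x,y)\le 0,\ H(x,y)=0,\ h(x,y)=0,\ \nabla_yL(x,y,u,v)=0,\ (-g_i(x,y),u_i)\in\Omega\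 (i=1,\dots,m).$$ **Corollary 5.1.** Let $z^*=(x^*,y^*,u^*,v^*)$ be a local solution of (CP). Suppose that $V$ is finite and Lipschitz continuous on a neighbourhood of $x^*$; that LICQ holds at $y^*$ for the lower-level problem $\min_{y\in Y(x^*)}f(x^*,y)$, i.e. the vectors $\nabla_yh_j(x^*,y^*)$ $(1\le j\le n)$ and $\nabla_yg_i(x^*,y^*)$ $(g_i(x^*,y^*)=0)$ are linearly independent; and that, with $\mathcal I^*=\{i: g_i(x^*,y^*)=0,\ u_i^*>0\}$, the matrix $$\begin{bmatrix}\nabla h(x^*,y^*)\\ \nabla H(x^*,y^*)\\ \nabla g_{\mathcal I^*}(x^*,y^*)\end{bmatrix}$$ has full column rank $d+s$. Then: 1. $z^*$ is an M-stationary point of (CP): regarding all functions as functions of $z=(x,y,u,v)$ and writing $\partial$ for the limiting (Mordukhovich) subdifferential, there are $\lambda_0\ge0$, $\lambda^G\in\mathbb R^p$ with $\lambda^G\ge0$ and $\lambda^G_i=0$ whenever $G_i(x^*,y^*)\neq0$, $\lambda^H\in\mathbb R^q$, $\lambda^h\in\mathbb R^n$, $\beta\in\mathbb R^s$, and $\alpha,\gamma\in\mathbb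 R^m$ with $$0\in\partial F(z^*)+\lambda_0\,\partial(f-V)(z^*)+\sum_i\lambda^G_i\nabla G_i(z^*)+\sum_i\lambda^H_i\nabla H_i(z^*)+\sum_j\lambda^h_j\nabla h_j(z^*)+\sum_k\beta_k\nabla(\nabla_yL)_k(z^*)+\sum_i\alpha_i\nabla g_i(z^*)-\sum_i\gamma_i\nabla u_i,$$ where $\gamma_i=0$ if $g_i(x^*,y^*)=0<u_i^*$; $\alpha_i=0$ if $g_i(x^*,y^*)<0=u_i^*$; and either $\alpha_i>0,\gamma_i>0$ or $\alpha_i\gamma_i=0$ if $g_i(x^*,y^*)=0=u^*_i$. 2. For any choice of norms on $\mathbb R^q,\mathbb R^n,\mathbb R^p,\mathbb R^s$ and of the norm on $\mathbb R^2$ that defines the distance $d_\Omega$ to $\Omega$, there is $\mu\ge0$ such that $z^*$ is a local minimizer, without constraints, of $$\text{(CP}_\mu)\quad \min_{x,y,u,v}\ F(x,y)+\mu\Big[(f(x,y)-V(x))_++\|H(x,y)\|+\|h(x,y)\|+\|G_+(x,y)\|+\|\nabla_yL(x,y,u,v)\|+\sum_{i=1}^m d_\Omega(-g_i(x,y),u_i)\Big].$$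 -/

import Mathlib

open Set Filter Topology

noncomputable section

/-! ## Variational analysis

Subgradients in a finite-dimensional space are represented by the linear functionals
`x ↦ ⟨ζ, x⟩` that they induce, and gradients of smooth functions by derivatives `fderiv`. All notions
below depend only on the topology of `E`, not on the choice of the norm. -/

section VariationalAnalysis

variable {E : Type*} [NormedAddCommGroup E] [NormedSpace ℝ E]

/-- The regular (Fréchet) subdifferential: `φ x' - φ x - ⟨ζ, x' - x⟩ ≥ o(‖x' - x‖)`. -/
def regularSubdiff (φ : E → ℝ) (x : E) : Set (E →L[ℝ] ℝ) :=
  {ζ | ∀ ε > 0, ∀ᶠ x' in 𝓝 x, -ε * ‖x' - x‖ ≤ φ x' - φ x - ζ (x' - x)}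

/-- The limiting (Mordukhovich) subdifferential. -/
def limitingSubdiff (φ : E → ℝ) (x : E) : Set (E →L[ℝ] ℝ) :=
  {ζ | ∃ (xs : ℕ → E) (ζs : ℕ → E →L[ℝ] ℝ),
    Tendsto xs atTop (𝓝 x) ∧ Tendsto (fun k => φ (xs k)) atTop (𝓝 (φ x)) ∧
    (∀ k, ζs k ∈ regularSubdiff φ (xs k)) ∧ Tendsto ζs atTop (𝓝 ζ)}

/-- M-stationarity of the feasible point `z` for the program
`min φ(z)` subject to `a i z ≤ 0`, `b j z = 0`, `0 ≤ A k z ⊥ B k z ≥ 0`,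
where `φ` and the `a i` are locally Lipschitz and the `b j`, `A k`, `B k` are smooth:
`0 ∈ ∂φ(z) + ∑ lam i ∂(a i)(z) + ∑ eta j ∇(b j)(z) - ∑ alpha k ∇(A k)(z) - ∑ beta k ∇(B k)(z)`
with the sign conditions on the multipliers. -/
def IsMStationary {ι κ ρ : Type*} [Fintype ι] [Fintype κ] [Fintype ρ]
    (φ : E → ℝ) (a : ι → E → ℝ) (b : κ → E → ℝ) (A B : ρ → E → ℝ) (z : E) : Prop :=
  ∃ (ζ : E →L[ℝ] ℝ) (w : ι → E →L[ℝ] ℝ) (lam : ι → ℝ) (eta : κ → ℝ) (alpha beta : ρ → ℝ),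
    ζ ∈ limitingSubdiff φ z ∧
    (∀ i, a i z = 0 → w i ∈ limitingSubdiff (a i) z) ∧
    (∀ i, 0 ≤ lam i) ∧
    (∀ i, a i z ≠ 0 → lam i = 0) ∧
    (∀ k, A k z = 0 → 0 < B k z → beta k = 0) ∧
    (∀ k, 0 < A k z → B k z = 0 → alpha k = 0) ∧
    (∀ k, A k z = 0 → B k z = 0 → (0 < alpha k ∧ 0 < beta k) ∨ alpha k * beta k = 0) ∧
    0 = ζ + ∑ i, lam i • w i + ∑ j, eta j • fderiv ℝ (b j) z
      - ∑ k, alpha k • fderiv ℝ (A k) z - ∑ k, beta k • fderiv ℝ (B k) z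

/-- A seminorm that is a norm. -/
def IsNorm (N : Seminorm ℝ E) : Prop := ∀ x, N x = 0 → x = 0

end VariationalAnalysis

/-- The complementarity set `Ω = {(a, b) : 0 ≤ a ⊥ b ≥ 0}` in the plane. -/
def complSet : Set (ℝ × ℝ) := {w | 0 ≤ w.1 ∧ 0 ≤ w.2 ∧ w.1 * w.2 = 0}

/-- The distance of `(a, b)` to the complementarity set, measured in the norm `N`. -/
def complDist (N : Seminorm ℝ (ℝ × ℝ)) (a b : ℝ) : ℝ := ⨅ w : complSet, N ((a, b) - (w : ℝ × ℝ))

/-- The componentwise positive part of a vector. -/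
def vecPos {k : ℕ} (v : EuclideanSpace ℝ (Fin k)) : EuclideanSpace ℝ (Fin k) :=
  WithLp.toLp 2 (fun i => max 0 (v i))

/-- The data of the bilevel program: minimize `F(x,y)` subject to `y ∈ S(x)`, `G(x,y) ≤ 0`,
`H(x,y) = 0`, where `S(x)` is the solution set of the lower-level program of minimizing `f(x,·)`
subject to `g(x,y) ≤ 0`, `h(x,y) = 0`. -/
structure BilevelProgram (d s m n p q : ℕ) where
  F : EuclideanSpace ℝ (Fin d) × EuclideanSpace ℝ (Fin s) → ℝ
  G : EuclideanSpace ℝ (Fin d) × EuclideanSpace ℝ (Fin s) → EuclideanSpace ℝ (Fin p)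
  H : EuclideanSpace ℝ (Fin d) × EuclideanSpace ℝ (Fin s) → EuclideanSpace ℝ (Fin q)
  f : EuclideanSpace ℝ (Fin d) × EuclideanSpace ℝ (Fin s) → ℝ
  g : EuclideanSpace ℝ (Fin d) × EuclideanSpace ℝ (Fin s) → EuclideanSpace ℝ (Fin m)
  h : EuclideanSpace ℝ (Fin d) × EuclideanSpace ℝ (Fin s) → EuclideanSpace ℝ (Fin n)

/-- The partial gradient `∇_y φ(x,y)` at the point `w = (x,y)`. -/
def gradY {d s : ℕ} (φ : EuclideanSpace ℝ (Fin d) × EuclideanSpace ℝ (Fin s) → ℝ)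
    (w : EuclideanSpace ℝ (Fin d) × EuclideanSpace ℝ (Fin s)) : EuclideanSpace ℝ (Fin s) :=
  gradient (fun y => φ (w.1, y)) w.2

/-- The space of the variables `(x, y, u, v)` of the combined program. -/
abbrev CPSpace (d s m n : ℕ) : Type :=
  EuclideanSpace ℝ (Fin d) × EuclideanSpace ℝ (Fin s) ×
    EuclideanSpace ℝ (Fin m) × EuclideanSpace ℝ (Fin n)

namespace CPSpace

variable {d s m n : ℕ}

/-- The component `(x, y)` of `(x, y, u, v)`. -/
def xy (z : CPSpace d s m n) : EuclideanSpace ℝ (Fin d) × EuclideanSpace ℝ (Fin s) := (z.1, z.2.1)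

/-- The component `u` of `(x, y, u, v)`. -/
def u (z : CPSpace d s m n) : EuclideanSpace ℝ (Fin m) := z.2.2.1

/-- The component `v` of `(x, y, u, v)`. -/
def v (z : CPSpace d s m n) : EuclideanSpace ℝ (Fin n) := z.2.2.2

end CPSpace

namespace BilevelProgram

variable {d s m n p q : ℕ} (P : BilevelProgram d s m n p q)

/-- Standing smoothness assumptions: `F` is locally Lipschitz, `G`, `H`, `f`, `g`, `h` are
continuously differentiable, and so are the partial gradients in `y` of `f` and of the components of
`g` and `h` (as functions of `(x,y)`). -/
structure IsSmooth : Prop where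
  F_lip : LocallyLipschitz P.F
  G_smooth : ContDiff ℝ 1 P.G
  H_smooth : ContDiff ℝ 1 P.H
  f_smooth : ContDiff ℝ 1 P.f
  g_smooth : ContDiff ℝ 1 P.g
  h_smooth : ContDiff ℝ 1 P.h
  gradY_f_smooth : ContDiff ℝ 1 (gradY P.f)
  gradY_g_smooth : ∀ i, ContDiff ℝ 1 (gradY fun w => P.g w i)
  gradY_h_smooth : ∀ j, ContDiff ℝ 1 (gradY fun w => P.h w j)

/-- The lower-level feasible set `Y(x)`. -/
def lowerFeasible (x : EuclideanSpace ℝ (Fin d)) : Set (EuclideanSpace ℝ (Fin s)) :=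
  {y | (∀ i, P.g (x, y) i ≤ 0) ∧ P.h (x, y) = 0}

/-- The value function `V(x) = inf {f(x,y) : y ∈ Y(x)}`, with values in `[-∞, ∞]`. -/
def value (x : EuclideanSpace ℝ (Fin d)) : EReal :=
  ⨅ y ∈ P.lowerFeasible x, (P.f (x, y) : EReal)

/-- `V` is (finite and) Lipschitz continuous around `x`. -/
def ValueLipschitzAt (x : EuclideanSpace ℝ (Fin d)) : Prop :=
  ∃ U ∈ 𝓝 x, (∀ x' ∈ U, P.value x' ≠ ⊥ ∧ P.value x' ≠ ⊤) ∧
    ∃ K, LipschitzOnWith K (fun x' => (P.value x').toReal) U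

/-- LICQ at `y` for the lower-level program with parameter `x`: the vectors `∇_y h_j(x,y)`, all `j`,
and `∇_y g_i(x,y)`, `i` active, are linearly independent. -/
def LowerLICQ (x : EuclideanSpace ℝ (Fin d)) (y : EuclideanSpace ℝ (Fin s)) : Prop :=
  LinearIndependent ℝ
    (Sum.elim (fun j : Fin n => gradY (fun w => P.h w j) (x, y))
      (fun i : {i : Fin m // P.g (x, y) i = 0} => gradY (fun w => P.g w i) (x, y)))

/-- `∇_y L(x,y,u,v) = ∇_y f(x,y) + ∇_y g(x,y)ᵀ u + ∇_y h(x,y)ᵀ v`. -/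
def gradYL (z : CPSpace d s m n) : EuclideanSpace ℝ (Fin s) :=
  gradY P.f z.xy + ∑ i, z.u i • gradY (fun w => P.g w i) z.xy
    + ∑ j, z.v j • gradY (fun w => P.h w j) z.xy

/-- The feasible set of the combined program (CP). -/
def cpFeasible : Set (CPSpace d s m n) :=
  {z | (P.f z.xy : EReal) ≤ P.value z.1 ∧ (∀ i, P.G z.xy i ≤ 0) ∧ P.H z.xy = 0 ∧
    P.h z.xy = 0 ∧ P.gradYL z = 0 ∧ ∀ i, (-P.g z.xy i, z.u i) ∈ complSet}

/-- `z` is a local solution of (CP). -/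
def IsLocalSolutionCP (z : CPSpace d s m n) : Prop :=
  z ∈ P.cpFeasible ∧ IsLocalMinOn (fun z' => P.F z'.xy) P.cpFeasible z

/-- The function `f(x,y) - V(x)`. It is only used around points where `V` is finite. -/
def gap (z : CPSpace d s m n) : ℝ := P.f z.xy - (P.value z.1).toReal

/-- M-stationarity for (CP): inequality constraints `f - V ≤ 0` and `G ≤ 0`; equality
constraints `H = 0`, `h = 0` and `∇_y L = 0`; complementarity constraints `0 ≤ -g ⊥ u ≥ 0`. -/
def IsMStationaryCP (z : CPSpace d s m n) : Prop :=
  IsMStationary (fun z' : CPSpace d s m n => P.F z'.xy)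
    (Sum.elim (fun (_ : Unit) z' => P.gap z') (fun (i : Fin p) z' => P.G z'.xy i))
    (Sum.elim (fun (i : Fin q) z' => P.H z'.xy i)
      (Sum.elim (fun (j : Fin n) z' => P.h z'.xy j) (fun (k : Fin s) z' => P.gradYL z' k)))
    (fun (i : Fin m) z' => -P.g z'.xy i) (fun (i : Fin m) z' => z'.u i) z

/-- The penalty function `φ_CP`, for a choice of the norms in the five spaces involved. -/
def penalty (NH : Seminorm ℝ (EuclideanSpace ℝ (Fin q))) (Nh : Seminorm ℝ (EuclideanSpace ℝ (Fin n)))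
    (NG : Seminorm ℝ (EuclideanSpace ℝ (Fin p))) (NL : Seminorm ℝ (EuclideanSpace ℝ (Fin s)))
    (NΩ : Seminorm ℝ (ℝ × ℝ)) (z : CPSpace d s m n) : ℝ :=
  max 0 (P.gap z) + NH (P.H z.xy) + Nh (P.h z.xy) + NG (vecPos (P.G z.xy)) + NL (P.gradYL z)
    + ∑ i, complDist NΩ (-P.g z.xy i) (z.u i)

/-- The index set `I* = {i : g_i(x,y) = 0, u_i > 0}`. -/
def activePos (z : CPSpace d s m n) : Set (Fin m) := {i | P.g z.xy i = 0 ∧ 0 < z.u i}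

/-- The matrix with the rows `∇h_j(x,y)`, `∇H_i(x,y)` (all `j`, `i`) and `∇g_i(x,y)`, `i ∈ I*`;
its columns are the `d + s` partial derivatives in the coordinates of `(x,y)`. -/
def stackedJacobian (z : CPSpace d s m n) :
    Matrix (Fin n ⊕ Fin q ⊕ P.activePos z) (Fin d ⊕ Fin s) ℝ :=
  Matrix.of fun r c =>
    fderiv ℝ
      ((Sum.elim (fun j w => P.h w j)
        (Sum.elim (fun i w => P.H w i) (fun (i : P.activePos z) w => P.g w i)) :
        Fin n ⊕ Fin q ⊕ P.activePos z →
          EuclideanSpace ℝ (Fin d) × EuclideanSpace ℝ (Fin s) → ℝ) r) z.xy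
      (Sum.elim (fun k => (EuclideanSpace.single k 1, 0)) (fun k => (0, EuclideanSpace.single k 1)) c)

end BilevelProgram

end

/-! ### Limiting subgradients and norms in finite dimensions. -/

section VariationalAnalysis

variable {E : Type*} [NormedAddCommGroup E] [NormedSpace ℝ E]

/-! The rank condition drives both conclusions. Full column rank of the stacked Jacobian says that
the gradients of `h`, `H` and of the `g_i` with `i ∈ I*` have trivial common kernel, equivalently
that they span the dual of the `(x, y)`-space.

Stationarity follows from spanning: `F` is locally Lipschitz, so it has a limiting subgradient, and
minus this subgradient is a combination of those gradients (`exists_eq_sum_fderiv_stackedMap`). All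
other multipliers can be zero, which settles every sign condition.

Exact penalization follows from the trivial kernel. Adjoin to the stacked functions the components
of `∇_y L` and the `u_i` with `g_i ≠ 0`. All of them vanish at `z`. A direction annihilated by all
their derivatives has zero `(x, y)`-part by the rank condition, and then zero `(u, v)`-part by LICQ,
since `∇_y L` is affine in `(u, v)`. The derivative of the system is therefore injective, and `‖z' -
z‖` is bounded near `z` by a multiple of the residuals (`IsSmooth.isBigO_sub`), hence of the
penalty. Since `F` decreases at most linearly in `‖z' - z‖`, a large `μ` compensates. -/

/-- If `φ + k ‖e (· - x)‖²` has a local minimum at `y`, then the negative of the derivative of the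
quadratic term is a regular subgradient of `φ`. -/
theorem neg_inner_mem_regularSubdiff {H : Type*} [NormedAddCommGroup H] [InnerProductSpace ℝ H]
    (e : E →L[ℝ] H) {φ : E → ℝ} {x y : E} {k : ℝ} (hk : 0 ≤ k)
    (hmin : IsLocalMin (fun w => φ w + k * ‖e (w - x)‖ ^ 2) y) :
    -(2 * k) • (innerSL ℝ (e (y - x))).comp e ∈ regularSubdiff φ y := by
  intro ε hε
  -- Expanding the square around `y` leaves the remainder `k ‖e (w - y)‖²`, which is at most this
  -- factor times `‖w - y‖`.
  have hc : Tendsto (fun w => k * ‖e‖ ^ 2 * ‖w - y‖) (𝓝 y) (𝓝 0) := by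
    have : Continuous fun w => k * ‖e‖ ^ 2 * ‖w - y‖ := by fun_prop
    simpa using this.tendsto y
  filter_upwards [hmin, hc.eventually_lt_const hε] with w hw hwε
  have hsplit : e (w - x) = e (y - x) + e (w - y) := by
    rw [← map_add]; congr 1; abel
  have hsq : ‖e (w - y)‖ ^ 2 ≤ ‖e‖ ^ 2 * ‖w - y‖ ^ 2 := by
    rw [← mul_pow]
    exact pow_le_pow_left₀ (norm_nonneg _) (e.le_opNorm _) 2
  have hexp : ‖e (w - x)‖ ^ 2
      = ‖e (y - x)‖ ^ 2 + 2 * inner ℝ (e (y - x)) (e (w - y)) + ‖e (w - y)‖ ^ 2 := by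
    rw [hsplit, norm_add_sq_real]
  have h1 := mul_le_mul_of_nonneg_left hsq hk
  have h2 := mul_le_mul_of_nonneg_right hwε.le (norm_nonneg (w - y))
  rw [hexp] at hw
  simp only [smul_apply, ContinuousLinearMap.comp_apply, innerSL_apply_apply,
    smul_eq_mul]
  nlinarith

/-- A function that is Lipschitz around a point of a finite-dimensional space has a limiting
subgradient there. -/
theorem limitingSubdiff_nonempty [FiniteDimensional ℝ E] {φ : E → ℝ} {x : E} {U : Set E}
    (hU : U ∈ 𝓝 x) {K : NNReal} (hφ : LipschitzOnWith K φ U) : (limitingSubdiff φ x).Nonempty := by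
  have : ProperSpace E := FiniteDimensional.proper ℝ E
  -- The norm of `E` need not be differentiable away from zero, so the quadratic perturbation is
  -- measured in Euclidean coordinates.
  let e : E ≃L[ℝ] EuclideanSpace ℝ (Fin (Module.finrank ℝ E)) := toEuclidean
  set c : ℝ := ‖(e.symm : EuclideanSpace ℝ (Fin (Module.finrank ℝ E)) →L[ℝ] E)‖ with hc
  set M : ℝ := 2 * (K * c) * ‖(e : E →L[ℝ] EuclideanSpace ℝ (Fin (Module.finrank ℝ E)))‖ with hM
  have hKc : 0 ≤ K * c := by positivity
  have hec (v : E) : ‖v‖ ≤ c * ‖e v‖ := by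
    simpa using (e.symm : EuclideanSpace ℝ (Fin (Module.finrank ℝ E)) →L[ℝ] E).le_opNorm (e v)
  obtain ⟨r, hr, hrU⟩ := Metric.nhds_basis_closedBall.mem_iff.1 hU
  have hx : x ∈ Metric.closedBall x r := Metric.mem_closedBall_self hr.le
  have key (δ : ℝ) (hδ : 0 < δ) :
      ∃ y ζ, ‖y - x‖ < δ ∧ ζ ∈ regularSubdiff φ y ∧ ‖ζ‖ ≤ M := by
    -- A minimizer `y` of the perturbed function on the ball satisfies `k ‖e (y - x)‖ ≤ K c`. A
    -- large `k` thus puts `y` within `δ` of `x` and in the open ball, while the gradient of the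
    -- perturbation stays bounded by `M` independently of `k`.
    obtain ⟨k, hk0, hk⟩ : ∃ k : ℝ, 0 < k ∧ c * (K * c) / k < min δ r := by
      have ht : Tendsto (fun k : ℝ => c * (K * c) / k) atTop (𝓝 0) :=
        tendsto_const_nhds.div_atTop tendsto_id
      obtain ⟨k, h1, h2⟩ := ((eventually_gt_atTop 0).and
        (ht.eventually_lt_const (lt_min hδ hr))).exists
      exact ⟨k, h1, h2⟩
    obtain ⟨y, hy, hmin⟩ := (isCompact_closedBall x r).exists_isMinOn ⟨x, hx⟩
      (f := fun w => φ w + k * ‖e (w - x)‖ ^ 2)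
      ((hφ.mono hrU).continuousOn.add (by fun_prop))
    have hle : φ y + k * ‖e (y - x)‖ ^ 2 ≤ φ x := by simpa using hmin hx
    have hlip : φ x - φ y ≤ K * ‖y - x‖ := by
      have := hφ.dist_le_mul x (hrU hx) y (hrU hy)
      rw [Real.dist_eq, dist_comm, dist_eq_norm] at this
      exact (le_abs_self _).trans this
    have hbound : k * ‖e (y - x)‖ ≤ K * c := by
      rcases (norm_nonneg (e (y - x))).eq_or_lt with h0 | h0
      · rw [← h0]; simpa using hKc
      · refine le_of_mul_le_mul_right ?_ h0
        have := mul_le_mul_of_nonneg_left (hec (y - x)) K.2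
        simp only [NNReal.val_eq_coe] at this
        nlinarith
    have hyx : ‖y - x‖ < min δ r := by
      refine lt_of_le_of_lt ((hec _).trans ?_) hk
      rw [mul_div_assoc]
      exact mul_le_mul_of_nonneg_left ((le_div_iff₀' hk0).2 hbound) (norm_nonneg _)
    have hnhds : Metric.closedBall x r ∈ 𝓝 y :=
      Metric.closedBall_mem_nhds_of_mem (by
        rw [Metric.mem_ball, dist_eq_norm]; exact hyx.trans_le (min_le_right _ _))
    refine ⟨y, _, hyx.trans_le (min_le_left _ _),
      neg_inner_mem_regularSubdiff (e : E →L[ℝ] EuclideanSpace ℝ (Fin (Module.finrank ℝ E))) hk0.le (hmin.isLocalMin hnhds), ?_⟩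
    rw [norm_smul, norm_neg, Real.norm_of_nonneg (by positivity)]
    refine (mul_le_mul_of_nonneg_left (ContinuousLinearMap.opNorm_comp_le _ _)
      (by positivity)).trans ?_
    rw [innerSL_apply_norm]
    have := mul_le_mul_of_nonneg_right hbound (norm_nonneg (e : E →L[ℝ] EuclideanSpace ℝ (Fin (Module.finrank ℝ E))))
    simp only [ContinuousLinearEquiv.coe_coe] at *
    rw [hM]
    linarith
  choose! ys ζs hys hζ hζM using key
  have hpos (n : ℕ) : (0 : ℝ) < 1 / (n + 1) := by positivity
  -- The uniform bound `M` makes the regular subgradients at points tending to `x` subconverge.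
  obtain ⟨ζ, -, σ, hσ, hlim⟩ := (isCompact_closedBall (0 : E →L[ℝ] ℝ) M).tendsto_subseq
    (x := fun n : ℕ => ζs (1 / (n + 1))) (fun n => by simpa using hζM _ (hpos n))
  have hys' : Tendsto (fun n : ℕ => ys (1 / (n + 1))) atTop (𝓝 x) := by
    rw [tendsto_iff_norm_sub_tendsto_zero]
    exact squeeze_zero (fun _ => norm_nonneg _) (fun n => (hys _ (hpos n)).le)
      tendsto_one_div_add_atTop_nhds_zero_nat
  exact ⟨ζ, fun n => ys (1 / (σ n + 1)), fun n => ζs (1 / (σ n + 1)),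
    hys'.comp hσ.tendsto_atTop,
    ((hφ.continuousOn.continuousAt hU).tendsto.comp hys').comp hσ.tendsto_atTop,
    fun n => hζ _ (hpos _), hlim⟩

/-- The limiting subdifferential of a function that depends on some of the variables only. -/
theorem comp_mem_limitingSubdiff_comp {E' : Type*} [NormedAddCommGroup E'] [NormedSpace ℝ E']
    {φ : E' → ℝ} (π : E →L[ℝ] E') (σ : E' →L[ℝ] E) (hσ : ∀ w, π (σ w) = w) {x : E}
    {ζ : E' →L[ℝ] ℝ} (hζ : ζ ∈ limitingSubdiff φ (π x)) :
    ζ.comp π ∈ limitingSubdiff (fun z => φ (π z)) x := by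
  obtain ⟨xs, ζs, hxs, hφ, hreg, hlim⟩ := hζ
  -- The approximating points are lifted by the section `σ`, shifted so that the lifts converge to
  -- `x`.
  have hproj (k : ℕ) : π (x + σ (xs k - π x)) = xs k := by simp [hσ]
  refine ⟨fun k => x + σ (xs k - π x), fun k => (ζs k).comp π, ?_, ?_, fun k ε hε => ?_, ?_⟩
  · have : Continuous fun w => x + σ (w - π x) := by fun_prop
    have h := (this.tendsto (π x)).comp hxs
    rwa [sub_self, map_zero, add_zero] at h
  · simpa only [hproj] using hφ
  -- The added `1` allows division when `π = 0`.
  · have hC : 0 < ‖π‖ + 1 := by positivity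
    have h := (π.continuous.tendsto (x + σ (xs k - π x))).eventually
      (by rw [hproj]; exact hreg k (ε / (‖π‖ + 1)) (div_pos hε hC))
    filter_upwards [h] with z hz
    rw [hproj]
    have hπ : π z - xs k = π (z - (x + σ (xs k - π x))) := by rw [map_sub, hproj]
    rw [hπ] at hz
    refine le_trans ?_ hz
    have h1 : ‖π (z - (x + σ (xs k - π x)))‖ ≤ (‖π‖ + 1) * ‖z - (x + σ (xs k - π x))‖ :=
      (π.le_opNorm _).trans (by gcongr; linarith)
    have h2 := mul_le_mul_of_nonneg_left h1 (div_pos hε hC).le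
    rw [← mul_assoc, div_mul_cancel₀ _ hC.ne'] at h2
    linarith
  · have : Continuous fun ξ : E' →L[ℝ] ℝ => ξ.comp π := by fun_prop
    exact (this.tendsto ζ).comp hlim

/-- A norm on a finite-dimensional space dominates the given one. -/
theorem IsNorm.exists_norm_le [FiniteDimensional ℝ E] {N : Seminorm ℝ E} (hN : IsNorm N) :
    ∃ C > 0, ∀ x, ‖x‖ ≤ C * N x := by
  have : ProperSpace E := FiniteDimensional.proper ℝ E
  rcases subsingleton_or_nontrivial E with h | h
  · exact ⟨1, one_pos, fun x => by simp [Subsingleton.elim x 0]⟩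
  have hcont : Continuous N := (ConvexOn.locallyLipschitz N.convexOn).continuous
  obtain ⟨x₀, hx₀, hmin⟩ := (isCompact_sphere (0 : E) 1).exists_isMinOn
    (NormedSpace.sphere_nonempty.2 zero_le_one) hcont.continuousOn
  have hne : x₀ ≠ 0 := ne_zero_of_mem_unit_sphere ⟨x₀, hx₀⟩
  have hpos : 0 < N x₀ := (apply_nonneg N x₀).lt_of_ne fun h => hne (hN x₀ h.symm)
  refine ⟨(N x₀)⁻¹, inv_pos.2 hpos, fun x => ?_⟩
  rcases eq_or_ne x 0 with rfl | hx
  · simp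
  have hx' := norm_pos_iff.2 hx
  have h1 : N x₀ ≤ N (‖x‖⁻¹ • x) := hmin (by simp [norm_smul, hx'.ne'])
  rw [map_smul_eq_mul, norm_inv, norm_norm, inv_mul_eq_div, le_div_iff₀ hx'] at h1
  rwa [inv_mul_eq_div, le_div_iff₀ hpos, mul_comm]

end VariationalAnalysis

/-! ### Residual bounds from the distance to the complementarity set. -/

section Complementarity

theorem complDist_nonneg (N : Seminorm ℝ (ℝ × ℝ)) (a b : ℝ) : 0 ≤ complDist N a b :=
  Real.iInf_nonneg fun _ => apply_nonneg N _

theorem complDist_eq_zero (N : Seminorm ℝ (ℝ × ℝ)) {a b : ℝ} (h : (a, b) ∈ complSet) :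
    complDist N a b = 0 := by
  refine le_antisymm ?_ (complDist_nonneg N a b)
  have hb : BddBelow (range fun w : complSet => N ((a, b) - (w : ℝ × ℝ))) :=
    ⟨0, by rintro _ ⟨w, rfl⟩; exact apply_nonneg N _⟩
  exact (ciInf_le hb ⟨(a, b), h⟩).trans (by simp)

/-- Every point of the complementarity set lies on a coordinate axis, so its difference from `(a,
b)` has `a` or `b` as a coordinate. -/
theorem min_abs_le_complDist {N : Seminorm ℝ (ℝ × ℝ)} {C : ℝ} (hC : 0 < C)
    (hN : ∀ w, ‖w‖ ≤ C * N w) (a b : ℝ) : min |a| |b| ≤ C * complDist N a b := by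
  have : Nonempty complSet := ⟨⟨(0, 0), by simp [complSet]⟩⟩
  rw [← div_le_iff₀' hC]
  refine le_ciInf fun ⟨w, _, _, hw⟩ => ?_
  rw [div_le_iff₀' hC]
  refine le_trans ?_ (hN _)
  rw [Prod.norm_def]
  rcases mul_eq_zero.1 hw with h | h
  · exact (min_le_left _ _).trans (le_max_of_le_left (by simp [h]))
  · exact (min_le_right _ _).trans (le_max_of_le_right (by simp [h]))

/-- Near a point with `a = 0 < |b|`, the distance to the complementarity set controls `a`. -/
theorem isBigO_complDist_left {X : Type*} [TopologicalSpace X] {N : Seminorm ℝ (ℝ × ℝ)}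
    (hN : IsNorm N) {A B : X → ℝ} {x : X} (hA : ContinuousAt A x) (hB : ContinuousAt B x)
    (h0 : A x = 0) (hne : B x ≠ 0) : A =O[𝓝 x] fun y => complDist N (A y) (B y) := by
  obtain ⟨C, hC, hCN⟩ := hN.exists_norm_le
  refine Asymptotics.IsBigO.of_bound C ?_
  filter_upwards [hA.abs.eventually_lt hB.abs (by simpa [h0] using hne)] with y hy
  rw [Real.norm_eq_abs, Real.norm_of_nonneg (complDist_nonneg _ _ _)]
  simpa [min_eq_left hy.le] using min_abs_le_complDist hC hCN (A y) (B y)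

/-- Near a point with `b = 0 < |a|`, the distance to the complementarity set controls `b`. -/
theorem isBigO_complDist_right {X : Type*} [TopologicalSpace X] {N : Seminorm ℝ (ℝ × ℝ)}
    (hN : IsNorm N) {A B : X → ℝ} {x : X} (hA : ContinuousAt A x) (hB : ContinuousAt B x)
    (h0 : B x = 0) (hne : A x ≠ 0) : B =O[𝓝 x] fun y => complDist N (A y) (B y) := by
  obtain ⟨C, hC, hCN⟩ := hN.exists_norm_le
  refine Asymptotics.IsBigO.of_bound C ?_
  filter_upwards [hB.abs.eventually_lt hA.abs (by simpa [h0] using hne)] with y hy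
  rw [Real.norm_eq_abs, Real.norm_of_nonneg (complDist_nonneg _ _ _)]
  simpa [min_eq_right hy.le] using min_abs_le_complDist hC hCN (A y) (B y)

theorem IsNorm.isBigO {X E : Type*} [NormedAddCommGroup E] [NormedSpace ℝ E]
    [FiniteDimensional ℝ E] {N : Seminorm ℝ E} (hN : IsNorm N) (f : X → E) (l : Filter X) :
    f =O[l] fun x => N (f x) := by
  obtain ⟨C, hC, hCN⟩ := hN.exists_norm_le
  refine Asymptotics.IsBigO.of_bound C (Eventually.of_forall fun x => ?_)
  rw [Real.norm_of_nonneg (apply_nonneg _ _)]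
  exact hCN _

end Complementarity

/-- An injective linear map on a finite-dimensional space is bounded below, so increments of the
system are comparable to `z' - z` near `z`. -/
theorem isBigO_sub_of_fderiv_injective {E ι : Type*} [NormedAddCommGroup E] [NormedSpace ℝ E]
    [FiniteDimensional ℝ E] [Fintype ι] {Φ : ι → E → ℝ} {z : E} {ψ : E → ℝ}
    (hd : ∀ r, DifferentiableAt ℝ (Φ r) z) (h0 : ∀ r, Φ r z = 0)
    (hinj : ∀ v, (∀ r, fderiv ℝ (Φ r) z v = 0) → v = 0) (hO : ∀ r, Φ r =O[𝓝 z] ψ) :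
    (fun z' => z' - z) =O[𝓝 z] ψ := by
  let L : E →L[ℝ] ι → ℝ := ContinuousLinearMap.pi fun r => fderiv ℝ (Φ r) z
  have hL : HasFDerivAt (fun z' r => Φ r z') L z :=
    hasFDerivAt_pi.2 fun r => (hd r).hasFDerivAt
  obtain ⟨K, -, hK⟩ := (L : E →ₗ[ℝ] ι → ℝ).exists_antilipschitzWith
    (LinearMap.ker_eq_bot'.2 fun v hv => hinj v fun r => congrFun hv r)
  have hind : IsInducing L := (hK.isUniformInducing L.uniformContinuous).isInducing
  refine (hL.isTheta_sub hind).isBigO_symm.trans (Asymptotics.isBigO_pi.2 fun r => ?_)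
  simpa [h0] using hO r

theorem EuclideanSpace.isBigO_apply {X : Type*} {k : ℕ} (f : X → EuclideanSpace ℝ (Fin k))
    (l : Filter X) (i : Fin k) : (fun x => f x i) =O[l] f :=
  Asymptotics.IsBigO.of_bound 1 (Eventually.of_forall fun x => by
    simpa using PiLp.norm_apply_le (f x) i)

/-! ### Coordinates on the space of `(x, y, u, v)`. -/

namespace CPSpace

variable {d s m n : ℕ}

instance : ContinuousSMul ℝ (CPSpace d s m n) := IsBoundedSMul.continuousSMul

/-- The projection `(x, y, u, v) ↦ (x, y)` as a continuous linear map. -/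
def xyL : CPSpace d s m n →L[ℝ] EuclideanSpace ℝ (Fin d) × EuclideanSpace ℝ (Fin s) :=
  (ContinuousLinearMap.fst ℝ _ _).prod
    ((ContinuousLinearMap.fst ℝ _ _).comp (ContinuousLinearMap.snd ℝ _ _))

/-- The embedding `(x, y) ↦ (x, y, 0, 0)`. -/
def embXY : EuclideanSpace ℝ (Fin d) × EuclideanSpace ℝ (Fin s) →L[ℝ] CPSpace d s m n :=
  (ContinuousLinearMap.fst ℝ _ _).prod ((ContinuousLinearMap.snd ℝ _ _).prod 0)

theorem xyL_apply (z : CPSpace d s m n) : xyL z = z.xy := rfl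

theorem xyL_embXY (w : EuclideanSpace ℝ (Fin d) × EuclideanSpace ℝ (Fin s)) :
    xyL (embXY w : CPSpace d s m n) = w := rfl

theorem fderiv_comp_xy {F : Type*} [NormedAddCommGroup F] [NormedSpace ℝ F]
    {φ : EuclideanSpace ℝ (Fin d) × EuclideanSpace ℝ (Fin s) → F} {z : CPSpace d s m n}
    (hφ : DifferentiableAt ℝ φ z.xy) :
    fderiv ℝ (fun z' : CPSpace d s m n => φ z'.xy) z = (fderiv ℝ φ z.xy).comp xyL :=
  (hφ.hasFDerivAt.comp z (xyL.hasFDerivAt (x := z))).fderiv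

theorem differentiable_xy : Differentiable ℝ (xy : CPSpace d s m n → _) := xyL.differentiable

theorem differentiable_u (i : Fin m) : Differentiable ℝ fun z : CPSpace d s m n => z.u i := by
  unfold u; fun_prop

theorem differentiable_v (j : Fin n) : Differentiable ℝ fun z : CPSpace d s m n => z.v j := by
  unfold v; fun_prop

theorem fderiv_u (z w : CPSpace d s m n) (i : Fin m) :
    fderiv ℝ (fun z' : CPSpace d s m n => z'.u i) z w = w.u i := by
  let L : CPSpace d s m n →L[ℝ] ℝ := (EuclideanSpace.proj i).comp
    ((ContinuousLinearMap.fst ℝ _ _).comp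
      ((ContinuousLinearMap.snd ℝ _ _).comp (ContinuousLinearMap.snd ℝ _ _)))
  exact congrArg (fun T : CPSpace d s m n →L[ℝ] ℝ => T w) (L.hasFDerivAt (x := z)).fderiv

end CPSpace

/-! ### Rank condition, LICQ and the local error bound. -/

namespace BilevelProgram

variable {d s m n p q : ℕ} (P : BilevelProgram d s m n p q)

/-- The functions whose gradients are the rows of the stacked Jacobian. -/
def stackedMap (z : CPSpace d s m n) : Fin n ⊕ Fin q ⊕ P.activePos z →
    EuclideanSpace ℝ (Fin d) × EuclideanSpace ℝ (Fin s) → ℝ :=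
  Sum.elim (fun j w => P.h w j) (Sum.elim (fun i w => P.H w i) (fun i w => P.g w i))

variable {P}

theorem IsSmooth.differentiable_stackedMap (hP : P.IsSmooth) (z : CPSpace d s m n)
    (r : Fin n ⊕ Fin q ⊕ P.activePos z) : Differentiable ℝ (P.stackedMap z r) := by
  have hh := hP.h_smooth.differentiable one_ne_zero
  have hH := hP.H_smooth.differentiable one_ne_zero
  have hg := hP.g_smooth.differentiable one_ne_zero
  rcases r with j | i | i <;> simp only [stackedMap, Sum.elim_inl, Sum.elim_inr] <;> fun_prop

/-- The rank equals the number of columns, so the columns are independent and the matrix acts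
injectively on coordinate vectors. -/
theorem eq_zero_of_fderiv_stackedMap_eq_zero {z : CPSpace d s m n}
    (hrank : (P.stackedJacobian z).rank = d + s)
    {w : EuclideanSpace ℝ (Fin d) × EuclideanSpace ℝ (Fin s)}
    (hw : ∀ r, fderiv ℝ (P.stackedMap z r) z.xy w = 0) : w = 0 := by
  have hli : LinearIndependent ℝ (P.stackedJacobian z).col := by
    rw [linearIndependent_iff_card_eq_finrank_span, Set.finrank,
      ← Matrix.rank_eq_finrank_span_cols, hrank]
    simp
  have hinj := Matrix.mulVec_injective_iff.2 hli
  have hdecomp : w = ∑ c : Fin d ⊕ Fin s, (Sum.elim (fun k => w.1 k) (fun k => w.2 k) c : ℝ) •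
      ((Sum.elim (fun k => (EuclideanSpace.single k 1, 0))
        (fun k => (0, EuclideanSpace.single k 1)) c :
          EuclideanSpace ℝ (Fin d) × EuclideanSpace ℝ (Fin s))) := by
    rw [Fintype.sum_sum_type]
    ext k <;> simp [Prod.fst_sum, Prod.snd_sum, Pi.single_apply]
  have hzero : (P.stackedJacobian z).mulVec (Sum.elim (fun k => w.1 k) (fun k => w.2 k)) = 0 := by
    ext r
    rw [Pi.zero_apply, ← hw r]
    conv_rhs => rw [hdecomp]
    rw [map_sum]
    simp only [Matrix.mulVec, dotProduct, map_smul, smul_eq_mul]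
    exact Finset.sum_congr rfl fun c _ => mul_comm _ _
  have h := hinj (hzero.trans (Matrix.mulVec_zero _).symm)
  ext k
  · simpa using congrFun h (Sum.inl k)
  · simpa using congrFun h (Sum.inr k)

/-- Dual form of the rank condition: a functional vanishing on the common kernel of finitely many
functionals lies in their span, and here that kernel is zero. -/
theorem exists_eq_sum_fderiv_stackedMap {z : CPSpace d s m n} [Fintype (P.activePos z)]
    (hrank : (P.stackedJacobian z).rank = d + s)
    (ζ : EuclideanSpace ℝ (Fin d) × EuclideanSpace ℝ (Fin s) →L[ℝ] ℝ) :
    ∃ c : Fin n ⊕ Fin q ⊕ P.activePos z → ℝ, ζ = ∑ r, c r • fderiv ℝ (P.stackedMap z r) z.xy := by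
  have hker : ⨅ r, LinearMap.ker (fderiv ℝ (P.stackedMap z r) z.xy).toLinearMap
      ≤ LinearMap.ker ζ.toLinearMap := by
    intro w hw
    have : w = 0 := eq_zero_of_fderiv_stackedMap_eq_zero hrank fun r => by
      simpa using (Submodule.mem_iInf _).1 hw r
    simp [this]
  obtain ⟨c, hc⟩ := (Submodule.mem_span_range_iff_exists_fun ℝ).1 (mem_span_of_iInf_ker_le_ker hker)
  refine ⟨c, ContinuousLinearMap.ext fun w => ?_⟩
  simpa using (LinearMap.congr_fun hc w).symm

theorem IsSmooth.differentiable_gradYL (hP : P.IsSmooth) : Differentiable ℝ P.gradYL := by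
  have hxy := CPSpace.differentiable_xy (d := d) (s := s) (m := m) (n := n)
  refine ((hP.gradY_f_smooth.differentiable one_ne_zero).comp hxy).add
    (Differentiable.fun_sum fun i _ => ?_) |>.add (Differentiable.fun_sum fun j _ => ?_)
  · exact (CPSpace.differentiable_u i).smul
      (((hP.gradY_g_smooth i).differentiable one_ne_zero).comp hxy)
  · exact (CPSpace.differentiable_v j).smul
      (((hP.gradY_h_smooth j).differentiable one_ne_zero).comp hxy)

/-- The Lagrangian gradient is affine in the multipliers `(u, v)`. -/
theorem IsSmooth.fderiv_gradYL_of_xy_eq_zero (hP : P.IsSmooth) (z w : CPSpace d s m n)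
    (hw : w.xy = 0) :
    fderiv ℝ P.gradYL z w = ∑ i, w.u i • gradY (fun w' => P.g w' i) z.xy
      + ∑ j, w.v j • gradY (fun w' => P.h w' j) z.xy := by
  -- Along `z + t • w` the point `(x, y)` is frozen, so the line derivative is the slope of an
  -- affine function of `t`.
  refine ((hP.differentiable_gradYL z).hasFDerivAt.hasLineDerivAt w).unique ?_
  have hline (t : ℝ) : P.gradYL (z + t • w) = P.gradYL z
      + t • (∑ i, w.u i • gradY (fun w' => P.g w' i) z.xy
        + ∑ j, w.v j • gradY (fun w' => P.h w' j) z.xy) := by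
    have h1 : (z + t • w).xy = z.xy := by
      change CPSpace.xyL (z + t • w) = _
      rw [map_add, map_smul, CPSpace.xyL_apply, CPSpace.xyL_apply, hw, smul_zero, add_zero]
    have hu (i : Fin m) : (z + t • w).u i = z.u i + t * w.u i := rfl
    have hv (j : Fin n) : (z + t • w).v j = z.v j + t * w.v j := rfl
    simp only [gradYL, h1, hu, hv, add_smul, Finset.sum_add_distrib, smul_add, Finset.smul_sum,
      smul_smul]
    abel
  rw [HasLineDerivAt]
  simp only [hline]
  have h := ((hasDerivAt_id (0 : ℝ)).smul_const (∑ i, w.u i • gradY (fun w' => P.g w' i) z.xy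
    + ∑ j, w.v j • gradY (fun w' => P.h w' j) z.xy)).const_add (P.gradYL z)
  rwa [one_smul] at h

/-- A local error bound: the distance to a feasible point at which the rank condition and LICQ hold
is controlled by the constraint violation. -/
theorem IsSmooth.isBigO_sub (hP : P.IsSmooth) {z : CPSpace d s m n} (hz : z ∈ P.cpFeasible)
    (hLICQ : P.LowerLICQ z.1 z.2.1) (hrank : (P.stackedJacobian z).rank = d + s)
    {ψ : CPSpace d s m n → ℝ} (hH : (fun z' => P.H z'.xy) =O[𝓝 z] ψ)
    (hh : (fun z' => P.h z'.xy) =O[𝓝 z] ψ) (hL : P.gradYL =O[𝓝 z] ψ)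
    (hg : ∀ i, P.g z.xy i = 0 → 0 < z.u i → (fun z' => P.g z'.xy i) =O[𝓝 z] ψ)
    (hu : ∀ i, P.g z.xy i ≠ 0 → (fun z' => z'.u i) =O[𝓝 z] ψ) :
    (fun z' => z' - z) =O[𝓝 z] ψ := by
  classical
  obtain ⟨-, -, hzH, hzh, hzL, hzΩ⟩ := hz
  have hu0 (i : Fin m) (hi : P.g z.xy i ≠ 0) : z.u i = 0 := by
    simpa [hi] using (hzΩ i).2.2
  -- The `u_i` with `g_i ≠ 0` are included because LICQ does not control the corresponding
  -- gradients; they vanish at `z` by complementarity.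
  let Φ : (Fin n ⊕ Fin q ⊕ P.activePos z) ⊕ Fin s ⊕ {i : Fin m // P.g z.xy i ≠ 0} →
      CPSpace d s m n → ℝ :=
    Sum.elim (fun r z' => P.stackedMap z r z'.xy)
      (Sum.elim (fun k z' => P.gradYL z' k) (fun i z' => z'.u i))
  have hdL := hP.differentiable_gradYL
  refine isBigO_sub_of_fderiv_injective (Φ := Φ) ?_ ?_ (fun w hw => ?_) ?_
  · rintro (r | k | i)
    · exact (hP.differentiable_stackedMap z r _).comp z (CPSpace.differentiable_xy z)
    · simp only [Φ, Sum.elim_inl, Sum.elim_inr]; fun_prop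
    · exact CPSpace.differentiable_u i.1 z
  · rintro ((j | i | i) | k | i)
    · simp [Φ, stackedMap, hzh]
    · simp [Φ, stackedMap, hzH]
    · exact i.2.1
    · simp [Φ, hzL]
    · exact hu0 i i.2
  · have hxy : w.xy = 0 := eq_zero_of_fderiv_stackedMap_eq_zero hrank fun r => by
      have h := hw (Sum.inl r)
      simp only [Φ, Sum.elim_inl] at h
      rwa [CPSpace.fderiv_comp_xy (hP.differentiable_stackedMap z r _)] at h
    have hL0 : fderiv ℝ P.gradYL z w = 0 := by
      ext k
      have h := hw (Sum.inr (Sum.inl k))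
      simp only [Φ, Sum.elim_inl, Sum.elim_inr] at h
      have h' := ((EuclideanSpace.proj k : _ →L[ℝ] ℝ).hasFDerivAt.comp z (hdL z).hasFDerivAt).fderiv
      exact (congrArg (fun T : CPSpace d s m n →L[ℝ] ℝ => T w) h').symm.trans h
    have hwu (i : Fin m) (hi : P.g z.xy i ≠ 0) : w.u i = 0 := by
      have h := hw (Sum.inr (Sum.inr ⟨i, hi⟩))
      simp only [Φ, Sum.elim_inr] at h
      rwa [CPSpace.fderiv_u] at h
    rw [hP.fderiv_gradYL_of_xy_eq_zero z w hxy] at hL0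
    -- With the inactive `u`-components already zero, the vanishing derivative of `∇_y L` is a
    -- linear relation among exactly the LICQ vectors.
    have hcoef := Fintype.linearIndependent_iff.1 hLICQ
      (Sum.elim (fun j => w.v j) (fun i => w.u i)) (by
        rw [Fintype.sum_sum_type, ← hL0, add_comm]
        congr 1
        rw [← Fintype.sum_subtype_add_sum_subtype (fun i => P.g z.xy i = 0)
          (fun i => w.u i • gradY (fun w' => P.g w' i) z.xy)]
        have h0 : ∑ i : {i // ¬P.g z.xy i = 0}, w.u i • gradY (fun w' => P.g w' i) z.xy = 0 :=
          Finset.sum_eq_zero fun i _ => by rw [hwu i i.2, zero_smul]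
        rw [h0, add_zero]
        rfl)
    have hw1 : w.1 = 0 := congrArg Prod.fst hxy
    have hw2 : w.2.1 = 0 := congrArg Prod.snd hxy
    have hw3 : w.2.2.1 = 0 := by
      ext i
      by_cases hi : P.g z.xy i = 0
      · exact hcoef (Sum.inr ⟨i, hi⟩)
      · exact hwu i hi
    have hw4 : w.2.2.2 = 0 := by
      ext j
      exact hcoef (Sum.inl j)
    exact Prod.ext hw1 (Prod.ext hw2 (Prod.ext hw3 hw4))
  · rintro ((j | i | i) | k | i)
    · exact (EuclideanSpace.isBigO_apply _ _ j).trans hh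
    · exact (EuclideanSpace.isBigO_apply _ _ i).trans hH
    · exact hg i i.2.1 i.2.2
    · exact (EuclideanSpace.isBigO_apply _ _ k).trans hL
    · exact hu i i.2

/-! ### Exact penalization. -/

section Penalty

variable (P) (NH : Seminorm ℝ (EuclideanSpace ℝ (Fin q)))
  (Nh : Seminorm ℝ (EuclideanSpace ℝ (Fin n))) (NG : Seminorm ℝ (EuclideanSpace ℝ (Fin p)))
  (NL : Seminorm ℝ (EuclideanSpace ℝ (Fin s))) (NΩ : Seminorm ℝ (ℝ × ℝ))

theorem penalty_bounds (z : CPSpace d s m n) :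
    0 ≤ P.penalty NH Nh NG NL NΩ z ∧ NH (P.H z.xy) ≤ P.penalty NH Nh NG NL NΩ z ∧
    Nh (P.h z.xy) ≤ P.penalty NH Nh NG NL NΩ z ∧ NL (P.gradYL z) ≤ P.penalty NH Nh NG NL NΩ z ∧
    ∀ i, complDist NΩ (-P.g z.xy i) (z.u i) ≤ P.penalty NH Nh NG NL NΩ z := by
  have h1 := le_max_left 0 (P.gap z)
  have h2 := apply_nonneg NH (P.H z.xy)
  have h3 := apply_nonneg Nh (P.h z.xy)
  have h4 := apply_nonneg NG (vecPos (P.G z.xy))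
  have h5 := apply_nonneg NL (P.gradYL z)
  have h6 : 0 ≤ ∑ i, complDist NΩ (-P.g z.xy i) (z.u i) :=
    Finset.sum_nonneg fun i _ => complDist_nonneg _ _ _
  unfold penalty
  refine ⟨by linarith, by linarith, by linarith, by linarith, fun i => ?_⟩
  have h7 := Finset.single_le_sum (f := fun i => complDist NΩ (-P.g z.xy i) (z.u i))
    (fun i _ => complDist_nonneg _ _ _) (Finset.mem_univ i)
  simp only at h7
  linarith

variable {P} {z : CPSpace d s m n}

/-- Feasibility puts `y` in `Y(x)`, so `V ≤ f` as well as `f ≤ V`; the equality in `EReal` makes `V`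
finite here, and `toReal` is then harmless. -/
theorem gap_eq_zero (hz : z ∈ P.cpFeasible) : P.gap z = 0 := by
  have hle : P.value z.1 ≤ (P.f z.xy : EReal) :=
    iInf₂_le z.2.1 ⟨fun i => neg_nonneg.1 (hz.2.2.2.2.2 i).1, hz.2.2.2.1⟩
  rw [gap, ← le_antisymm hz.1 hle, EReal.toReal_coe, sub_self]

theorem penalty_eq_zero (hz : z ∈ P.cpFeasible) :
    P.penalty NH Nh NG NL NΩ z = 0 := by
  have hgap := gap_eq_zero hz
  obtain ⟨-, hG, hH, hh, hL, hΩ⟩ := hz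
  have hv : vecPos (P.G z.xy) = 0 := by
    ext i
    exact max_eq_left (hG i)
  simp [penalty, hgap, hH, hh, hL, hv, complDist_eq_zero NΩ (hΩ _)]

variable {NH Nh NL NΩ}

/-- Each residual in the error bound is controlled by one nonnegative summand of the penalty. For
complementarity pairs, the coordinate that is nonzero at `z` selects the axis, and the distance
controls the other coordinate. -/
theorem IsSmooth.isBigO_sub_penalty (hP : P.IsSmooth) (hNH : IsNorm NH) (hNh : IsNorm Nh)
    (hNL : IsNorm NL) (hNΩ : IsNorm NΩ) (hz : z ∈ P.cpFeasible)
    (hLICQ : P.LowerLICQ z.1 z.2.1) (hrank : (P.stackedJacobian z).rank = d + s) :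
    (fun z' => z' - z) =O[𝓝 z] P.penalty NH Nh NG NL NΩ := by
  have hb := P.penalty_bounds NH Nh NG NL NΩ
  have aux {φ : CPSpace d s m n → ℝ} (h0 : ∀ z', 0 ≤ φ z')
      (h : ∀ z', φ z' ≤ P.penalty NH Nh NG NL NΩ z') : φ =O[𝓝 z] P.penalty NH Nh NG NL NΩ :=
    Asymptotics.IsBigO.of_bound 1 (Eventually.of_forall fun z' => by
      simpa [abs_of_nonneg (h0 z'), abs_of_nonneg (hb z').1] using h z')
  have hΩ (i : Fin m) := aux (fun z' => complDist_nonneg NΩ (-P.g z'.xy i) (z'.u i))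
    fun z' => (hb z').2.2.2.2 i
  have hA (i : Fin m) : ContinuousAt (fun z' : CPSpace d s m n => -P.g z'.xy i) z := by
    have h := hP.g_smooth.continuous.comp
      (CPSpace.differentiable_xy (d := d) (s := s) (m := m) (n := n)).continuous
    exact (((EuclideanSpace.proj i : _ →L[ℝ] ℝ).continuous.comp h).neg).continuousAt
  have hB (i : Fin m) : ContinuousAt (fun z' : CPSpace d s m n => z'.u i) z :=
    (CPSpace.differentiable_u i).continuous.continuousAt
  refine hP.isBigO_sub hz hLICQ hrank ((hNH.isBigO _ _).trans ?_) ((hNh.isBigO _ _).trans ?_)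
    ((hNL.isBigO _ _).trans ?_) (fun i hi hui => ?_) fun i hi => ?_
  · exact aux (fun _ => apply_nonneg _ _) fun z' => (hb z').2.1
  · exact aux (fun _ => apply_nonneg _ _) fun z' => (hb z').2.2.1
  · exact aux (fun _ => apply_nonneg _ _) fun z' => (hb z').2.2.2.1
  · refine Asymptotics.isBigO_neg_left.1 ?_
    exact (isBigO_complDist_left hNΩ (hA i) (hB i) (by simpa using hi) hui.ne').trans (hΩ i)
  · refine (isBigO_complDist_right hNΩ (hA i) (hB i) ?_ (by simpa using hi)).trans (hΩ i)
    simpa [hi] using (hz.2.2.2.2.2 i).2.2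

theorem IsSmooth.exists_isLocalMin_penalty (hP : P.IsSmooth) (hNH : IsNorm NH) (hNh : IsNorm Nh)
    (hNL : IsNorm NL) (hNΩ : IsNorm NΩ) (hz : z ∈ P.cpFeasible)
    (hLICQ : P.LowerLICQ z.1 z.2.1) (hrank : (P.stackedJacobian z).rank = d + s) :
    ∃ μ : ℝ, 0 ≤ μ ∧ IsLocalMin (fun z' => P.F z'.xy + μ * P.penalty NH Nh NG NL NΩ z') z := by
  obtain ⟨K, U, hU, hK⟩ := hP.F_lip z.xy
  obtain ⟨C, hC⟩ := (hP.isBigO_sub_penalty NG hNH hNh hNL hNΩ hz hLICQ hrank).bound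
  have hcont : ContinuousAt (CPSpace.xy : CPSpace d s m n → _) z :=
    CPSpace.differentiable_xy.continuous.continuousAt
  -- Lipschitz constant of `F` times the error bound constant, truncated at zero because `C` comes
  -- without a sign.
  refine ⟨K * max C 0, by positivity, ?_⟩
  filter_upwards [hC, hcont hU] with z' hz' hzU
  rw [P.penalty_eq_zero NH Nh NG NL NΩ hz, mul_zero, add_zero]
  have hpen := (P.penalty_bounds NH Nh NG NL NΩ z').1
  have h1 := hK.dist_le_mul _ hzU _ (mem_of_mem_nhds hU)
  rw [Real.dist_eq, dist_eq_norm] at h1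
  have h2 : ‖z'.xy - z.xy‖ ≤ ‖z' - z‖ :=
    max_le (norm_fst_le (z' - z)) ((norm_fst_le (z' - z).2).trans (norm_snd_le (z' - z)))
  rw [Real.norm_of_nonneg hpen] at hz'
  have h3 : ‖z' - z‖ ≤ max C 0 * P.penalty NH Nh NG NL NΩ z' :=
    hz'.trans (mul_le_mul_of_nonneg_right (le_max_left _ _) hpen)
  have h4 := mul_le_mul_of_nonneg_left (h2.trans h3) K.2
  simp only [NNReal.val_eq_coe] at h4
  rw [mul_assoc]
  linarith [neg_abs_le (P.F z'.xy - P.F z.xy)]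

end Penalty

/-! ### M-stationarity from the spanning property. -/

theorem IsSmooth.isMStationaryCP (hP : P.IsSmooth) {z : CPSpace d s m n}
    (hV : P.ValueLipschitzAt z.1) (hrank : (P.stackedJacobian z).rank = d + s) :
    P.IsMStationaryCP z := by
  classical
  obtain ⟨K, U, hU, hK⟩ := hP.F_lip z.xy
  obtain ⟨ζ, hζ⟩ := limitingSubdiff_nonempty hU hK
  obtain ⟨c, hc⟩ := exists_eq_sum_fderiv_stackedMap hrank ζ
  -- The inequality multipliers will be zero, but the definition still requires genuine limiting
  -- subgradients of the active inequality constraints.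
  have hgap : (limitingSubdiff P.gap z).Nonempty := by
    obtain ⟨UV, hUV, -, KV, hKV⟩ := hV
    obtain ⟨Kf, Uf, hUf, hKf⟩ := hP.f_smooth.locallyLipschitz z.xy
    have hf := hKf.comp ((CPSpace.xyL (d := d) (s := s) (m := m) (n := n)).lipschitz.lipschitzOnWith
      (s := CPSpace.xy ⁻¹' Uf)) fun _ h => h
    have hv := hKV.comp (LipschitzWith.prod_fst.lipschitzOnWith
      (s := (Prod.fst : CPSpace d s m n → _) ⁻¹' UV)) fun _ h => h
    exact limitingSubdiff_nonempty (inter_mem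
      (CPSpace.differentiable_xy.continuous.continuousAt hUf) (continuousAt_fst hUV))
      ((hf.mono inter_subset_left).sub (hv.mono inter_subset_right))
  have hG (i : Fin p) : (limitingSubdiff (fun z' : CPSpace d s m n => P.G z'.xy i) z).Nonempty := by
    have h : ContDiff ℝ 1 fun z' : CPSpace d s m n => P.G z'.xy i :=
      (EuclideanSpace.proj i : _ →L[ℝ] ℝ).contDiff.comp
        (hP.G_smooth.comp (CPSpace.xyL (d := d) (s := s) (m := m) (n := n)).contDiff)
    obtain ⟨K, U, hU, hK⟩ := h.locallyLipschitz z
    exact limitingSubdiff_nonempty hU hK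
  obtain ⟨ω, hω⟩ := hgap
  choose wG hwG using hG
  -- The coefficients `-c` cancel `ζ`. Those of `g` keep this sign since the complementarity
  -- function is `-g` and its sum is subtracted.
  refine ⟨ζ.comp CPSpace.xyL, Sum.elim (fun _ => ω) wG, 0,
    Sum.elim (fun i => -c (Sum.inr (Sum.inl i))) (Sum.elim (fun j => -c (Sum.inl j)) 0),
    fun i => if hi : i ∈ P.activePos z then -c (Sum.inr (Sum.inr ⟨i, hi⟩)) else 0, 0,
    comp_mem_limitingSubdiff_comp CPSpace.xyL CPSpace.embXY CPSpace.xyL_embXY hζ, ?_,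
    fun _ => le_rfl, fun _ _ => rfl, fun _ _ _ => rfl, fun i hi _ => ?_,
    fun _ _ _ => Or.inr (mul_zero _), ?_⟩
  · rintro (_ | i) -
    · exact hω
    · exact hwG i
  · refine dif_neg fun h => hi.ne' ?_
    exact neg_eq_zero.2 h.1
  · have hdH (i : Fin q) : fderiv ℝ (fun z' : CPSpace d s m n => P.H z'.xy i) z
        = (fderiv ℝ (P.stackedMap z (Sum.inr (Sum.inl i))) z.xy).comp CPSpace.xyL :=
      CPSpace.fderiv_comp_xy (hP.differentiable_stackedMap z (Sum.inr (Sum.inl i)) _)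
    have hdh (j : Fin n) : fderiv ℝ (fun z' : CPSpace d s m n => P.h z'.xy j) z
        = (fderiv ℝ (P.stackedMap z (Sum.inl j)) z.xy).comp CPSpace.xyL :=
      CPSpace.fderiv_comp_xy (hP.differentiable_stackedMap z (Sum.inl j) _)
    have hdg (i : P.activePos z) : fderiv ℝ (fun z' : CPSpace d s m n => -P.g z'.xy i) z
        = -(fderiv ℝ (P.stackedMap z (Sum.inr (Sum.inr i))) z.xy).comp CPSpace.xyL := by
      rw [fderiv_fun_neg]
      exact congrArg _
        (CPSpace.fderiv_comp_xy (hP.differentiable_stackedMap z (Sum.inr (Sum.inr i)) _))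
    have hsum : ∑ i, (if hi : i ∈ P.activePos z then -c (Sum.inr (Sum.inr ⟨i, hi⟩)) else 0) •
          fderiv ℝ (fun z' : CPSpace d s m n => -P.g z'.xy i) z
        = ∑ i : P.activePos z, c (Sum.inr (Sum.inr i)) •
          (fderiv ℝ (P.stackedMap z (Sum.inr (Sum.inr i))) z.xy).comp CPSpace.xyL := by
      rw [← Fintype.sum_subtype_add_sum_subtype (fun i => i ∈ P.activePos z), add_eq_left.2]
      · refine Finset.sum_congr rfl fun i _ => ?_
        rw [dif_pos i.2, hdg, neg_smul_neg]
      · exact Finset.sum_eq_zero fun i _ => by rw [dif_neg i.2, zero_smul]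
    simp only [Fintype.sum_sum_type, Sum.elim_inl, Sum.elim_inr, hdH, hdh, hsum, Pi.zero_apply,
      zero_smul, Finset.sum_const_zero]
    rw [hc]
    simp only [Fintype.sum_sum_type]
    refine ContinuousLinearMap.ext fun w => ?_
    simp
    ring

end BilevelProgram

theorem corollary5p1 {d s m n p q : ℕ} (P : BilevelProgram d s m n p q) (hP : P.IsSmooth)
    (NH : Seminorm ℝ (EuclideanSpace ℝ (Fin q))) (hNH : IsNorm NH)
    (Nh : Seminorm ℝ (EuclideanSpace ℝ (Fin n))) (hNh : IsNorm Nh)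
    (NG : Seminorm ℝ (EuclideanSpace ℝ (Fin p))) (hNG : IsNorm NG)
    (NL : Seminorm ℝ (EuclideanSpace ℝ (Fin s))) (hNL : IsNorm NL)
    (NΩ : Seminorm ℝ (ℝ × ℝ)) (hNΩ : IsNorm NΩ)
    (z : CPSpace d s m n) (hz : P.IsLocalSolutionCP z)
    (hV : P.ValueLipschitzAt z.1)
    (hLICQ : P.LowerLICQ z.1 z.2.1)
    (hrank : (P.stackedJacobian z).rank = d + s) :
    P.IsMStationaryCP z ∧
      ∃ μ : ℝ, 0 ≤ μ ∧
        IsLocalMin (fun z' => P.F z'.xy + μ * P.penalty NH Nh NG NL NΩ z') z := by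
  exact ⟨hP.isMStationaryCP hV hrank,
    hP.exists_isLocalMin_penalty NG hNH hNh hNL hNΩ hz.1 hLICQ hrank⟩
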